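/- For a positive integer $m$ write $[m]=\{1,\dots,m\}$. A function $\pi:[m]\to[m]$ is a parking function on $m$ cars if $\#\pi^{-1}([i])\ge i$ for every $i\in[m]$; for $T\subseteq[m]$ let $\mathrm{PF}_{m\mid T}$ be the set of parking functions on $m$ cars all of whose values lie in $T$. A composition $\lambda\vDash m$ of length $|\lambda|=n$ is an $n$-tuple $(\lambda_1,\dots,\lambda_n)$ of positive integers with sum $m$. **Theorem.** Let $g,s,k$ be positive integers with $1\le k<gs$, and let $S$ be the set of all natural numbers $j$ with $j\equiv 1\pmod g$. Then $$ s^{gs-k}=s\,\#\mathrm{PF}_{gs-k\mid S\cap[gs-k]}+\sum_{n=2}^{k}\frac{s}{n}\sum_{\substack{\lambda\vDash k\\|\lambda|=n}}\ \sum_{\substack{\mu\vDash s,\ |\mu|=n\\ g\mu_i>\lambda_i\text{ for all }i}}\binom{gs-k}{g\mu-\lambda}\prod_{i=1}^{n}\#\mathrm{PF}_{g\mu_i-\lambda_i\mid S\cap[g\mu_i-\lambda_i]}, $$ where $\binom{gs-k}{g\mu-\lambda}=\dfrac{(gs-k)!}{\prod_{i=1}^n (g\mu_i-\lambda_i)!}$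 is the multinomial coefficient. -/

import Mathlib

open Finset

/-- `π : [n] → [n]` is a parking function: for every `i ∈ [n]` at least `i` cars prefer one of the
first `i` spots (Catalan condition). Cars are indexed by `Fin n`, spots by `1, …, n`. -/
def IsParkingFunction (n : ℕ) (π : Fin n → ℕ) : Prop :=
  (∀ j, π j ∈ Icc 1 n) ∧ ∀ i ∈ Icc 1 n, i ≤ #{j : Fin n | π j ≤ i}

instance (n : ℕ) (π : Fin n → ℕ) : Decidable (IsParkingFunction n π) :=
  inferInstanceAs (Decidable (_ ∧ _))

/-- `PF_{n|S}`: the parking functions on `n` cars all of whose preferences lie in `S`. -/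
def restrictedPF (n : ℕ) (S : Finset ℕ) : Finset (Fin n → ℕ) :=
  {π ∈ Fintype.piFinset fun _ : Fin n => S | IsParkingFunction n π}

/-- `S ∩ [m]`, where `S` is the set of all natural numbers congruent to `1` modulo `g`. -/
def modSpots (g m : ℕ) : Finset ℕ := {j ∈ Icc 1 m | j ≡ 1 [MOD g]}

/-- The compositions of `m` with exactly `n` parts: `n`-tuples of positive integers with sum `m`. -/
def compositionsOfLength (n m : ℕ) : Finset (Fin n → ℕ) :=
  {c ∈ piAntidiag (univ : Finset (Fin n)) m | ∀ i, 0 < c i}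

/-!
The left-hand side counts preference functions of `N = g s - k` cars on a circle of `g s` spots in
which only the `s` spots congruent to `1` modulo `g` may be chosen. After parking, the `k` empty
spots cut the circle into `n` blocks, each a nonempty cluster of cars followed by a run of `λ i`
empty spots, of total length `g μ i`; hence the sum over pairs of compositions.

The proof replaces the circle by a street and generating functions in `w` (blocks of `g` spots) and
`z` (cars, exponentially). On a street with more spots than cars, the cars before the first empty
spot form a parking function and the remaining cars are unconstrained beyond that spot. This is
`pow_eq_sum_modPFCount`; in terms of the series `E` of all functions (`wordSeries`) and the series
`B` of initial clusters (`clusterSeries`) it says that `Q = E (1 - B)` has no monomial `w ^ s z ^ N`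
with `N < g s`. As `B` has only such monomials, `E = Q / (1 - B)` is a Wiener–Hopf factorisation,
and the logarithmic derivative `θ E / E = E - 1`, where `θ = w ∂/∂w`, splits: its part with
`N < g s` is `θ B / (1 - B)` (`wordSeriesBelow_mul_one_sub_clusterSeries`, with uniqueness from
`eq_zero_of_mul_add_mul_eq_zero`).

Since `1 - B = (1 - w) (1 - F)`, where `F` is the series of nonempty clusters followed by at least
one empty spot (`blockSeries`), the part `G` of `E` with `1 ≤ N < g s` is
`θ F / (1 - F) = θ (∑ F ^ n / n)`. Reading off the coefficient of `w ^ s z ^ (g s - k)` with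
`biCoeff_nonemptyWordSeries_eq_sum_pow_blockSeries` and `factorial_mul_biCoeff_blockSeries_pow`
gives the formula.
-/

/-! ### Decomposition by the initial cluster -/

theorem mem_modSpots_iff {g n j : ℕ} : j ∈ modSpots g n ↔ j ≤ n ∧ ∃ i, j = g * i + 1 := by
  unfold modSpots
  simp only [mem_filter, mem_Icc]
  constructor
  · rintro ⟨⟨h1, h2⟩, h3⟩
    obtain ⟨i, hi⟩ := (Nat.modEq_iff_dvd' h1).1 h3.symm
    exact ⟨h2, i, by omega⟩
  · rintro ⟨h1, i, rfl⟩
    exact ⟨⟨by omega, h1⟩, by simp [Nat.ModEq, Nat.add_mod]⟩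

theorem card_modSpots_filter_lt {g s m : ℕ} (hg : 1 ≤ g) :
    #{j ∈ modSpots g (g * s) | m + 1 < j} = s - (m / g + 1) := by
  have : {j ∈ modSpots g (g * s) | m + 1 < j} = (Ico (m / g + 1) s).image fun i => g * i + 1 := by
    ext j
    simp only [mem_filter, mem_modSpots_iff, mem_image, mem_Ico, Nat.succ_le_iff,
      Nat.div_lt_iff_lt_mul hg]
    constructor
    · rintro ⟨⟨h1, i, rfl⟩, h2⟩
      refine ⟨i, ⟨by rw [mul_comm]; omega, ?_⟩, rfl⟩
      exact Nat.lt_of_mul_lt_mul_left (a := g) (by omega)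
    · rintro ⟨i, ⟨h1, h2⟩, rfl⟩
      have := Nat.mul_lt_mul_of_pos_left h2 hg
      rw [mul_comm] at h1
      exact ⟨⟨by omega, i, rfl⟩, by omega⟩
  rw [this, card_image_of_injective, Nat.card_Ico]
  intro a b h
  exact Nat.eq_of_mul_eq_mul_left hg (by simpa using h)

theorem card_modSpots {g s : ℕ} (hg : 1 ≤ g) : #(modSpots g (g * s)) = s := by
  have : modSpots g (g * s) = (range s).image fun i => g * i + 1 := by
    ext j
    simp only [mem_modSpots_iff, mem_image, mem_range]
    constructor
    · rintro ⟨h1, i, rfl⟩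
      exact ⟨i, Nat.lt_of_mul_lt_mul_left (a := g) (by omega), rfl⟩
    · rintro ⟨i, h2, rfl⟩
      have := Nat.mul_lt_mul_of_pos_left h2 hg
      exact ⟨by omega, i, rfl⟩
  rw [this, card_image_of_injective, card_range]
  intro a b h
  exact Nat.eq_of_mul_eq_mul_left hg (by simpa using h)

/-- When the cars `j` with preferences `f j` park on a one-way street, `A` is the set of cars that
fill the spots before the first empty one: they occupy exactly the spots `1, …, #A`, and all other
cars prefer a spot beyond the empty spot `#A + 1`. -/
def IsInitialCluster {α : Type*} (A : Finset α) (f : α → ℕ) : Prop :=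
  (∀ j ∈ A, f j ≤ #A) ∧ (∀ j, j ∉ A → #A + 1 < f j) ∧ ∀ i ∈ Icc 1 #A, i ≤ #{j ∈ A | f j ≤ i}

/-- The size of the initial cluster is the least `m` such that at most `m` cars prefer one of the
spots `1, …, m + 1`. -/
theorem existsUnique_isInitialCluster {α : Type*} [Fintype α] (f : α → ℕ) :
    ∃! A : Finset α, IsInitialCluster A f := by
  classical
  have hex : ∃ m, #{j | f j ≤ m + 1} ≤ m := ⟨Fintype.card α, card_le_univ _⟩
  have hmin : ∀ i, i < Nat.find hex → i + 1 ≤ #{j | f j ≤ i + 1} := fun i hi => by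
    have := Nat.find_min hex hi
    omega
  set m := Nat.find hex with hm
  have hle : #{j | f j ≤ m + 1} ≤ m := Nat.find_spec hex
  have hge : m ≤ #{j | f j ≤ m} := by
    rcases Nat.eq_zero_or_pos m with h | h
    · omega
    · have := hmin (m - 1) (by omega)
      rwa [Nat.sub_add_cancel h] at this
  have hsubset : ({j | f j ≤ m} : Finset α) ⊆ ({j | f j ≤ m + 1} : Finset α) := fun j hj => by
    simp only [mem_filter, mem_univ, true_and] at hj ⊢; omega
  have heq : ({j | f j ≤ m} : Finset α) = ({j | f j ≤ m + 1} : Finset α) :=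
    eq_of_subset_of_card_le hsubset (hle.trans hge)
  have hcard : #{j | f j ≤ m} = m := le_antisymm (by rw [heq]; exact hle) hge
  refine ⟨({j | f j ≤ m} : Finset α), ⟨?_, ?_, ?_⟩, ?_⟩
  · intro j hj
    rw [hcard]
    simpa using hj
  · intro j hj
    rw [heq] at hj
    rw [hcard]
    simpa using hj
  · intro i hi
    rw [hcard, mem_Icc] at hi
    have := hmin (i - 1) (by omega)
    rw [Nat.sub_add_cancel hi.1] at this
    refine this.trans (card_le_card fun j hj => ?_)
    simp only [mem_filter, mem_univ, true_and] at hj ⊢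
    omega
  · rintro A ⟨h1, h2, h3⟩
    have hA : ∀ i, i ≤ #A + 1 → #A ≤ i → A = ({j | f j ≤ i} : Finset α) := by
      intro i hi hi'
      ext j
      simp only [mem_filter, mem_univ, true_and]
      refine ⟨fun h => (h1 j h).trans hi', fun h => ?_⟩
      by_contra hj
      have := h2 j hj
      omega
    have hAm : #A = m := by
      rw [hm, eq_comm, Nat.find_eq_iff]
      refine ⟨by rw [← hA _ le_rfl (by omega)], fun i hi => ?_⟩
      have h4 := h3 (i + 1) (by rw [mem_Icc]; omega)
      have h5 : #{j ∈ A | f j ≤ i + 1} ≤ #{j | f j ≤ i + 1} := card_le_card fun j hj => by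
        simp only [mem_filter, mem_univ, true_and] at hj ⊢
        exact hj.2
      omega
    exact hAm ▸ hA #A (by omega) le_rfl

/-- The number of parking functions on `m` cars all of whose values are congruent to `1`
modulo `g`. -/
def modPFCount (g m : ℕ) : ℕ := #(restrictedPF m (modSpots g m))

instance {α : Type*} [DecidableEq α] [Fintype α] (A : Finset α) (f : α → ℕ) :
    Decidable (IsInitialCluster A f) :=
  inferInstanceAs (Decidable (_ ∧ _ ∧ _))

theorem mem_restrictedPF {n : ℕ} {S : Finset ℕ} {π : Fin n → ℕ} :
    π ∈ restrictedPF n S ↔ (∀ j, π j ∈ S) ∧ (∀ j, π j ∈ Icc 1 n) ∧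
      ∀ i ∈ Icc 1 n, i ≤ #{j : Fin n | π j ≤ i} := by
  simp only [restrictedPF, mem_filter, Fintype.mem_piFinset]
  rfl

/-- A preference function with initial cluster `A` is a parking function on `A` together with an
arbitrary choice, for each remaining car, of a spot beyond `#A + 1`. -/
theorem card_isInitialCluster {α : Type*} [Fintype α] [DecidableEq α] {g s : ℕ} (hg : 1 ≤ g)
    (hs : Fintype.card α < g * s) (A : Finset α) :
    #{f ∈ Fintype.piFinset fun _ : α => modSpots g (g * s) | IsInitialCluster A f} =
      modPFCount g #A * (s - (#A / g + 1)) ^ (Fintype.card α - #A) := by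
  have hAle : #A ≤ Fintype.card α := card_le_univ A
  have hc : (s - (#A / g + 1)) ^ (Fintype.card α - #A) = #(Fintype.piFinset
      fun _ : {x // x ∉ A} => ({j ∈ modSpots g (g * s) | #A + 1 < j} : Finset ℕ)) := by
    rw [Fintype.card_piFinset, prod_const, card_modSpots_filter_lt hg, card_univ,
      Fintype.card_subtype_compl]
    simp
  have hcount : ∀ (f : α → ℕ) t, #{i : Fin #A | f (A.equivFin.symm i) ≤ t} =
      #{j ∈ A | f j ≤ t} := by
    intro f t
    refine card_bij (fun i _ => (A.equivFin.symm i : α)) ?_ ?_ ?_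
    · intro i hi
      simpa using hi
    · intro i _ j _ h
      simpa [Subtype.ext_iff] using h
    · intro j hj
      rw [mem_filter] at hj
      exact ⟨A.equivFin ⟨j, hj.1⟩, by simpa using hj.2, by simp⟩
  rw [modPFCount, hc, ← card_product]
  -- The parking function on `A` is transported to `Fin #A` along `A.equivFin`.
  refine card_nbij' (fun f => (fun i => f (A.equivFin.symm i), fun x => f x))
    (fun p x => if h : x ∈ A then p.1 (A.equivFin ⟨x, h⟩) else p.2 ⟨x, h⟩) ?_ ?_ ?_ ?_
  · intro f hf
    simp only [coe_filter, Set.mem_ofPred_eq, Fintype.mem_piFinset] at hf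
    obtain ⟨hf, h1, h2, h3⟩ := hf
    simp only [coe_product, Set.mem_prod, mem_coe, mem_restrictedPF, mem_filter,
      Fintype.mem_piFinset]
    have hmem : ∀ i, f (A.equivFin.symm i) ∈ modSpots g #A := fun i => by
      rw [mem_modSpots_iff]
      exact ⟨h1 _ (A.equivFin.symm i).2, (mem_modSpots_iff.1 (hf _)).2⟩
    refine ⟨⟨hmem, fun i => ?_, fun i hi => ?_⟩, fun x => ⟨hf x, h2 x x.2⟩⟩
    · exact (mem_filter.1 (hmem i)).1
    · rw [hcount]
      exact h3 i hi
  · rintro ⟨p, q⟩ hpq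
    simp only [coe_product, Set.mem_prod, mem_coe, mem_restrictedPF, mem_filter,
      Fintype.mem_piFinset] at hpq
    obtain ⟨⟨hp, hp', hp''⟩, hq⟩ := hpq
    simp only [coe_filter, Set.mem_ofPred_eq, Fintype.mem_piFinset]
    refine ⟨fun x => ?_, fun x hx => ?_, fun x hx => ?_, fun i hi => ?_⟩
    · split_ifs with hx
      · have := mem_modSpots_iff.1 (hp (A.equivFin ⟨x, hx⟩))
        exact mem_modSpots_iff.2 ⟨by omega, this.2⟩
      · exact (hq ⟨x, hx⟩).1
    · dsimp only
      rw [dif_pos hx]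
      exact (mem_modSpots_iff.1 (hp (A.equivFin ⟨x, hx⟩))).1
    · dsimp only
      rw [dif_neg hx]
      exact (hq ⟨x, hx⟩).2
    · rw [← hcount]
      simpa using hp'' i hi
  · intro f _
    ext x
    by_cases h : x ∈ A <;> simp [h]
  · rintro ⟨p, q⟩ _
    ext x
    · simp
    · simp [x.2]

/-- Sorting preference functions by their initial cluster. Since there are fewer cars than spots,
the first empty spot `m + 1` is one of the `g * s` spots, so the subtraction `s - (m / g + 1)` does
not truncate. -/
theorem pow_eq_sum_modPFCount {g s N : ℕ} (hg : 1 ≤ g) (hN : N < g * s) :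
    s ^ N = ∑ m ∈ range (N + 1), N.choose m * (modPFCount g m * (s - (m / g + 1)) ^ (N - m)) := by
  have h1 : s ^ N = #(Fintype.piFinset fun _ : Fin N => modSpots g (g * s)) := by
    rw [Fintype.card_piFinset_const, card_modSpots hg]
  have h2 : #(Fintype.piFinset fun _ : Fin N => modSpots g (g * s)) =
      ∑ A : Finset (Fin N),
        #{f ∈ Fintype.piFinset fun _ : Fin N => modSpots g (g * s) | IsInitialCluster A f} := by
    simp only [card_filter]
    rw [sum_comm, card_eq_sum_ones]
    refine sum_congr rfl fun f _ => ?_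
    obtain ⟨A, hA, hA'⟩ := existsUnique_isInitialCluster f
    rw [sum_eq_single A, if_pos hA]
    · intro A' _ hne
      exact if_neg fun h => hne (hA' A' h)
    · simp
  rw [h1, h2, ← powerset_univ,
    sum_congr rfl fun A _ => card_isInitialCluster (s := s) hg (by simpa using hN) A]
  simp only [Fintype.card_fin]
  rw [sum_powerset_apply_card fun m => modPFCount g m * (s - (m / g + 1)) ^ (N - m)]
  simp

/-! ### Power series in two variables -/

/-- The formal power series `∑ c s N w ^ s z ^ N`, encoded as a power series in `w` whose
coefficients are power series in `z`. -/
noncomputable def biSeries (c : ℕ → ℕ → ℚ) : PowerSeries (PowerSeries ℚ) :=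
  PowerSeries.mk fun s => PowerSeries.mk fun N => c s N

/-- The coefficient of `w ^ s z ^ N`. -/
noncomputable def biCoeff (s N : ℕ) (f : PowerSeries (PowerSeries ℚ)) : ℚ :=
  PowerSeries.coeff N (PowerSeries.coeff s f)

/-- The operator `w ∂/∂w`. -/
noncomputable def theta (f : PowerSeries (PowerSeries ℚ)) : PowerSeries (PowerSeries ℚ) :=
  PowerSeries.derivative (PowerSeries ℚ) f * PowerSeries.X

theorem theta_one : theta 1 = 0 := by
  simp [theta]

theorem theta_sub (f h : PowerSeries (PowerSeries ℚ)) : theta (f - h) = theta f - theta h := by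
  simp [theta, sub_mul]

theorem theta_mul (f h : PowerSeries (PowerSeries ℚ)) :
    theta (f * h) = f * theta h + h * theta f := by
  simp only [theta, Derivation.leibniz, smul_eq_mul]
  ring

theorem theta_pow (f : PowerSeries (PowerSeries ℚ)) (n : ℕ) :
    theta (f ^ n) = n • (f ^ (n - 1) * theta f) := by
  simp only [theta, Derivation.leibniz_pow, smul_eq_mul, smul_mul_assoc, mul_assoc]

theorem biSeries_ext {f h : PowerSeries (PowerSeries ℚ)}
    (H : ∀ s N, biCoeff s N f = biCoeff s N h) : f = h := by
  ext s N
  exact H s N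

@[simp] theorem biCoeff_biSeries (c : ℕ → ℕ → ℚ) (s N : ℕ) :
    biCoeff s N (biSeries c) = c s N := by
  simp [biCoeff, biSeries]

@[simp] theorem biCoeff_add (s N : ℕ) (f h : PowerSeries (PowerSeries ℚ)) :
    biCoeff s N (f + h) = biCoeff s N f + biCoeff s N h := by
  simp [biCoeff]

@[simp] theorem biCoeff_sub (s N : ℕ) (f h : PowerSeries (PowerSeries ℚ)) :
    biCoeff s N (f - h) = biCoeff s N f - biCoeff s N h := by
  simp [biCoeff]

theorem biCoeff_sum {ι : Type*} (t : Finset ι) (s N : ℕ)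
    (f : ι → PowerSeries (PowerSeries ℚ)) :
    biCoeff s N (∑ i ∈ t, f i) = ∑ i ∈ t, biCoeff s N (f i) := by
  simp [biCoeff]

theorem biCoeff_one (s N : ℕ) : biCoeff s N 1 = if s = 0 ∧ N = 0 then 1 else 0 := by
  rw [biCoeff, PowerSeries.coeff_one]
  split_ifs <;> simp_all [PowerSeries.coeff_one]

theorem biCoeff_mul (s N : ℕ) (f h : PowerSeries (PowerSeries ℚ)) :
    biCoeff s N (f * h) =
      ∑ p ∈ antidiagonal s, ∑ q ∈ antidiagonal N, biCoeff p.1 q.1 f * biCoeff p.2 q.2 h := by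
  simp [biCoeff, PowerSeries.coeff_mul]

theorem biCoeff_mul_X_zero (N : ℕ) (f : PowerSeries (PowerSeries ℚ)) :
    biCoeff 0 N (f * PowerSeries.X) = 0 := by
  simp [biCoeff]

theorem biCoeff_mul_X_succ (s N : ℕ) (f : PowerSeries (PowerSeries ℚ)) :
    biCoeff (s + 1) N (f * PowerSeries.X) = biCoeff s N f := by
  simp [biCoeff, PowerSeries.coeff_succ_mul_X]

theorem biCoeff_X (s N : ℕ) :
    biCoeff s N PowerSeries.X = if s = 1 ∧ N = 0 then 1 else 0 := by
  rw [biCoeff, PowerSeries.coeff_X]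
  split_ifs <;> simp_all [PowerSeries.coeff_one]

@[simp] theorem biCoeff_theta (s N : ℕ) (f : PowerSeries (PowerSeries ℚ)) :
    biCoeff s N (theta f) = s * biCoeff s N f := by
  rw [theta]
  cases s with
  | zero => simp [biCoeff_mul_X_zero]
  | succ s =>
    rw [biCoeff_mul_X_succ, biCoeff, PowerSeries.coeff_derivative, mul_comm]
    have : ((s : PowerSeries ℚ) + 1) = PowerSeries.C ((s : ℚ) + 1) := by simp
    rw [this, PowerSeries.coeff_C_mul]
    simp [biCoeff]

/-! ### Supports -/

/-- `f` only contains monomials `w ^ s z ^ N` with `N + j ≤ g s`. -/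
def SuppBelow (g j : ℕ) (f : PowerSeries (PowerSeries ℚ)) : Prop :=
  ∀ s N, g * s < N + j → biCoeff s N f = 0

/-- `f` only contains monomials `w ^ s z ^ N` with `g s ≤ N`. -/
def SuppAbove (g : ℕ) (f : PowerSeries (PowerSeries ℚ)) : Prop :=
  ∀ s N, N < g * s → biCoeff s N f = 0

theorem SuppBelow.mul {g i j : ℕ} {f h : PowerSeries (PowerSeries ℚ)} (hf : SuppBelow g i f)
    (hh : SuppBelow g j h) : SuppBelow g (i + j) (f * h) := by
  intro s N hsN
  rw [biCoeff_mul]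
  refine sum_eq_zero fun p hp => sum_eq_zero fun q hq => ?_
  rw [HasAntidiagonal.mem_antidiagonal] at hp hq
  rw [← hp, ← hq, mul_add] at hsN
  by_cases h1 : g * p.1 < q.1 + i
  · rw [hf _ _ h1, zero_mul]
  · rw [hh p.2 q.2 (by omega), mul_zero]

theorem SuppAbove.mul {g : ℕ} {f h : PowerSeries (PowerSeries ℚ)} (hf : SuppAbove g f)
    (hh : SuppAbove g h) : SuppAbove g (f * h) := by
  intro s N hsN
  rw [biCoeff_mul]
  refine sum_eq_zero fun p hp => sum_eq_zero fun q hq => ?_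
  rw [HasAntidiagonal.mem_antidiagonal] at hp hq
  rw [← hp, ← hq, mul_add] at hsN
  by_cases h1 : q.1 < g * p.1
  · rw [hf _ _ h1, zero_mul]
  · rw [hh p.2 q.2 (by omega), mul_zero]

theorem SuppBelow.sub {g j : ℕ} {f h : PowerSeries (PowerSeries ℚ)} (hf : SuppBelow g j f)
    (hh : SuppBelow g j h) : SuppBelow g j (f - h) := fun s N H => by
  simp [hf s N H, hh s N H]

theorem SuppAbove.sub {g : ℕ} {f h : PowerSeries (PowerSeries ℚ)} (hf : SuppAbove g f)
    (hh : SuppAbove g h) : SuppAbove g (f - h) := fun s N H => by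
  simp [hf s N H, hh s N H]

theorem SuppBelow.theta {g j : ℕ} {f : PowerSeries (PowerSeries ℚ)} (hf : SuppBelow g j f) :
    SuppBelow g j (theta f) := fun s N H => by
  simp [hf s N H]

theorem SuppAbove.theta {g : ℕ} {f : PowerSeries (PowerSeries ℚ)} (hf : SuppAbove g f) :
    SuppAbove g (theta f) := fun s N H => by
  simp [hf s N H]

theorem SuppBelow.mono {g i j : ℕ} (hij : i ≤ j) {f : PowerSeries (PowerSeries ℚ)}
    (hf : SuppBelow g j f) : SuppBelow g i f := fun s N H => hf s N (by omega)

theorem suppBelow_one (g : ℕ) : SuppBelow g 0 1 := fun s N H => by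
  rw [biCoeff_one, if_neg]
  rintro ⟨rfl, rfl⟩
  simp at H

theorem SuppBelow.pow {g : ℕ} {f : PowerSeries (PowerSeries ℚ)} (hf : SuppBelow g 1 f) (n : ℕ) :
    SuppBelow g n (f ^ n) := by
  induction n with
  | zero => simpa using suppBelow_one g
  | succ n ih => rw [pow_succ]; exact ih.mul hf

/-- The uniqueness behind a Wiener–Hopf factorisation: two series with complementary supports
cannot cancel, even after multiplication by series with constant term `1`, because the
coefficients of lowest order in `w` would have to cancel. -/
theorem eq_zero_of_mul_add_mul_eq_zero {g : ℕ} {V W P Q : PowerSeries (PowerSeries ℚ)}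
    (hV : SuppBelow g 1 V) (hW : SuppAbove g W) (hP : PowerSeries.coeff 0 P = 1)
    (hQ : PowerSeries.coeff 0 Q = 1) (h : V * Q + W * P = 0) : V = 0 := by
  have key : ∀ s, PowerSeries.coeff s V = 0 ∧ PowerSeries.coeff s W = 0 := by
    intro s
    induction s using Nat.strong_induction_on with
    | _ s ih =>
      have lead : ∀ U T : PowerSeries (PowerSeries ℚ), (∀ t < s, PowerSeries.coeff t U = 0) →
          PowerSeries.coeff 0 T = 1 →
          PowerSeries.coeff s (U * T) = PowerSeries.coeff s U := by
        intro U T hU hT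
        rw [PowerSeries.coeff_mul, sum_eq_single (s, 0)]
        · simp [hT]
        · rintro ⟨a, b⟩ hp hne
          rw [HasAntidiagonal.mem_antidiagonal] at hp
          have : a < s := by
            by_contra h
            exact hne (by ext <;> simp at hp ⊢ <;> omega)
          simp only
          rw [hU a this, zero_mul]
        · simp
      have h1 : PowerSeries.coeff s V + PowerSeries.coeff s W = 0 := by
        rw [← lead V Q (fun t ht => (ih t ht).1) hQ, ← lead W P (fun t ht => (ih t ht).2) hP,
          ← map_add, h, map_zero]
      have h2 : ∀ N, biCoeff s N V + biCoeff s N W = 0 := fun N => by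
        rw [biCoeff, biCoeff, ← map_add, h1, map_zero]
      constructor
      · ext N
        rcases lt_or_ge N (g * s) with hN | hN
        · have := h2 N
          rw [hW s N hN, add_zero] at this
          simpa [biCoeff] using this
        · simpa [biCoeff] using hV s N (by omega)
      · ext N
        rcases lt_or_ge N (g * s) with hN | hN
        · simpa [biCoeff] using hW s N hN
        · have := h2 N
          rw [hV s N (by omega), zero_add] at this
          simpa [biCoeff] using this
  ext1 s
  simpa using (key s).1

/-! ### The generating functions -/

/-- `∑ (w e ^ z) ^ s = 1 / (1 - w e ^ z)`, the generating function of all functions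
from `N` cars to `s` admissible spots. -/
noncomputable def wordSeries : PowerSeries (PowerSeries ℚ) :=
  PowerSeries.mk fun s => PowerSeries.exp ℚ ^ s

theorem biCoeff_wordSeries (s N : ℕ) :
    biCoeff s N wordSeries = (s : ℚ) ^ N / N.factorial := by
  rw [biCoeff, wordSeries, PowerSeries.coeff_mk, PowerSeries.exp_pow_eq_rescale_exp,
    PowerSeries.coeff_rescale, PowerSeries.coeff_exp]
  simp [div_eq_mul_inv]

/-- The logarithmic derivative of `E = 1 / (1 - w e ^ z)` is `E - 1`. -/
theorem theta_wordSeries : theta wordSeries = wordSeries * (wordSeries - 1) := by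
  have h : theta wordSeries + wordSeries = wordSeries * wordSeries := by
    ext1 s
    rw [PowerSeries.coeff_mul]
    have h1 : ∀ p ∈ antidiagonal s, PowerSeries.coeff p.1 wordSeries *
        PowerSeries.coeff p.2 wordSeries = PowerSeries.exp ℚ ^ s := fun p hp => by
      rw [HasAntidiagonal.mem_antidiagonal] at hp
      simp [wordSeries, ← pow_add, hp]
    rw [sum_congr rfl h1, sum_const, Nat.card_antidiagonal]
    ext N
    have h2 : PowerSeries.coeff N (PowerSeries.exp ℚ ^ s) = biCoeff s N wordSeries := by
      simp [biCoeff, wordSeries]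
    have h3 : PowerSeries.coeff N (PowerSeries.coeff s (theta wordSeries + wordSeries)) =
      biCoeff s N (theta wordSeries + wordSeries) := rfl
    rw [h3, map_nsmul, h2]
    simp
    ring
  rw [mul_sub, mul_one, ← h, add_sub_cancel_right]

/-- The exponential generating function of the counts `modPFCount g m`, where a cluster of `m` cars
together with the empty spot behind it is weighted by the least number `m / g + 1` of blocks of `g`
spots that contain them. -/
noncomputable def clusterSeries (g : ℕ) : PowerSeries (PowerSeries ℚ) :=
  biSeries fun s m => if s = m / g + 1 then (modPFCount g m : ℚ) / m.factorial else 0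

theorem suppBelow_clusterSeries {g : ℕ} (hg : 1 ≤ g) : SuppBelow g 1 (clusterSeries g) := by
  intro s N h
  rw [clusterSeries, biCoeff_biSeries, if_neg]
  rintro rfl
  have := Nat.lt_mul_div_succ N hg
  omega

/-- The decomposition by initial clusters, as an identity of coefficients. It fails for `g s ≤ N`,
where there need not be an empty spot. -/
theorem biCoeff_clusterSeries_mul_wordSeries {g s N : ℕ} (hg : 1 ≤ g) (hN : N < g * s) :
    biCoeff s N (clusterSeries g * wordSeries) = biCoeff s N wordSeries := by
  rw [biCoeff_mul, sum_comm, biCoeff_wordSeries, ← Nat.cast_pow, pow_eq_sum_modPFCount hg hN,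
    Nat.sum_antidiagonal_eq_sum_range_succ_mk, Nat.cast_sum, sum_div]
  refine sum_congr rfl fun m hm => ?_
  rw [mem_range] at hm
  have hms : m / g + 1 ≤ s := by
    rw [Nat.succ_le_iff, Nat.div_lt_iff_lt_mul hg, mul_comm]
    omega
  rw [sum_eq_single (m / g + 1, s - (m / g + 1))]
  · rw [clusterSeries, biCoeff_biSeries, if_pos rfl, biCoeff_wordSeries,
      Nat.choose_eq_factorial_div_factorial (by omega),
      Nat.cast_mul, Nat.cast_div (Nat.factorial_mul_factorial_dvd_factorial (by omega))
        (by positivity)]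
    push_cast
    have := Nat.factorial_pos N
    field_simp
  · rintro ⟨a, b⟩ hp hne
    rw [HasAntidiagonal.mem_antidiagonal] at hp
    rw [clusterSeries, biCoeff_biSeries, if_neg, zero_mul]
    rintro h
    simp only at hp h
    exact hne (by ext <;> simp <;> omega)
  · intro h
    exact absurd (HasAntidiagonal.mem_antidiagonal.2 (by simp; omega)) h

/-- The part of `wordSeries - 1` supported on the monomials `w ^ s z ^ N` with `N < g s`. -/
noncomputable def wordSeriesBelow (g : ℕ) : PowerSeries (PowerSeries ℚ) :=
  biSeries fun s N => if N < g * s then (s : ℚ) ^ N / N.factorial else 0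

/-- With `E = wordSeries` and `B = clusterSeries g`, the series `Q = E (1 - B)` has constant
term `1` and is supported on `g s ≤ N`, while `B` is supported on `N < g s`. Comparing logarithmic derivatives in `E = Q / (1 - B)` separates
`θ E / E = E - 1` into `θ B / (1 - B)`, supported on `N < g s`, and `θ Q / Q`, supported on
`g s ≤ N`. -/
theorem wordSeriesBelow_mul_one_sub_clusterSeries {g : ℕ} (hg : 1 ≤ g) :
    wordSeriesBelow g * (1 - clusterSeries g) = theta (clusterSeries g) := by
  set E := wordSeries with hE
  set B := clusterSeries g with hB
  set D := wordSeriesBelow g with hD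
  have hB1 : SuppBelow g 1 B := suppBelow_clusterSeries hg
  have hD1 : SuppBelow g 1 D := fun s N h => by
    rw [hD, wordSeriesBelow, biCoeff_biSeries, if_neg (by omega)]
  have hD2 : SuppAbove g (E - 1 - D) := fun s N h => by
    rw [biCoeff_sub, biCoeff_sub, hD, wordSeriesBelow, biCoeff_biSeries, if_pos h, hE,
      biCoeff_wordSeries, biCoeff_one, if_neg]
    · ring
    · rintro ⟨rfl, rfl⟩
      simp at h
  have hQ : SuppAbove g (E * (1 - B)) := fun s N h => by
    rw [mul_sub, mul_one, biCoeff_sub, mul_comm, hB, hE, biCoeff_clusterSeries_mul_wordSeries hg h,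
      sub_self]
  have hB0 : PowerSeries.coeff 0 B = 0 := by
    ext N
    have : biCoeff 0 N B = 0 := hB1 0 N (by omega)
    simpa [biCoeff] using this
  have hP0 : PowerSeries.coeff 0 (1 - B) = 1 := by
    rw [map_sub, hB0, sub_zero, PowerSeries.coeff_zero_one]
  have hE0 : PowerSeries.coeff 0 E = 1 := by simp [hE, wordSeries]
  have hQ0 : PowerSeries.coeff 0 (E * (1 - B)) = 1 := by
    rw [PowerSeries.coeff_mul, HasAntidiagonal.antidiagonal_zero, sum_singleton, hP0, hE0, one_mul]
  have hV : SuppBelow g 1 (D * (1 - B) - theta B) :=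
    (hD1.mul ((suppBelow_one g).sub (hB1.mono zero_le_one))).sub hB1.theta
  have hW : SuppAbove g ((E - 1 - D) * (E * (1 - B)) - theta (E * (1 - B))) :=
    (hD2.mul hQ).sub hQ.theta
  refine sub_eq_zero.1 (eq_zero_of_mul_add_mul_eq_zero hV hW hP0 hQ0 ?_)
  rw [theta_mul, theta_sub, theta_wordSeries, theta_one, ← hE]
  ring

/-- The generating function of single clusters on a circle: `w ^ μ z ^ m` marks a nonempty cluster
of `m` cars followed by `g μ - m ≥ 1` empty spots. -/
noncomputable def blockSeries (g : ℕ) : PowerSeries (PowerSeries ℚ) :=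
  biSeries fun s m => if 1 ≤ m ∧ m < g * s then (modPFCount g m : ℚ) / m.factorial else 0

/-- The part of `wordSeries` supported on the monomials `w ^ s z ^ N` with `1 ≤ N < g s`. -/
noncomputable def nonemptyWordSeries (g : ℕ) : PowerSeries (PowerSeries ℚ) :=
  biSeries fun s N => if 1 ≤ N ∧ N < g * s then (s : ℚ) ^ N / N.factorial else 0

/-- A cluster in minimally many blocks may be followed by any number of empty blocks, and
`clusterSeries` also contains the empty cluster, with weight `w`. -/
theorem one_sub_clusterSeries {g : ℕ} (hg : 1 ≤ g) :
    1 - clusterSeries g = (1 - blockSeries g) * (1 - PowerSeries.X) := by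
  suffices h : clusterSeries g = blockSeries g - blockSeries g * PowerSeries.X + PowerSeries.X by
    rw [h]; ring
  refine biSeries_ext fun s N => ?_
  rw [biCoeff_add, biCoeff_sub, biCoeff_X, clusterSeries, blockSeries, biCoeff_biSeries,
    biCoeff_biSeries]
  cases s with
  | zero => simp [biCoeff_mul_X_zero]
  | succ s =>
    rw [biCoeff_mul_X_succ, biCoeff_biSeries]
    have h1 : N < g * s ↔ N / g < s := by rw [Nat.div_lt_iff_lt_mul hg, mul_comm]
    have h2 : N < g * (s + 1) ↔ N / g < s + 1 := by rw [Nat.div_lt_iff_lt_mul hg, mul_comm]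
    simp only [h1, h2]
    rcases Nat.eq_zero_or_pos N with rfl | hN
    · have : modPFCount g 0 = 1 := by
        have := pow_eq_sum_modPFCount (g := g) (s := 1) (N := 0) hg (by omega)
        simpa using this.symm
      simp [this]
    · have hN' : N ≠ 0 := by omega
      rcases lt_trichotomy (N / g) s with h | h | h
      · simp [hN', h, Nat.one_le_iff_ne_zero, h.ne', Nat.lt_succ_of_lt h]
      · simp [hN', h, Nat.one_le_iff_ne_zero]
      · have h3 : ¬ N / g < s := by omega
        have h4 : ¬ N / g < s + 1 := by omega
        simp [hN', h3, h4, h.ne]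

theorem wordSeriesBelow_mul_one_sub_X {g : ℕ} (hg : 1 ≤ g) :
    wordSeriesBelow g * (1 - PowerSeries.X) =
      nonemptyWordSeries g * (1 - PowerSeries.X) + PowerSeries.X := by
  suffices h : (wordSeriesBelow g - nonemptyWordSeries g) -
      (wordSeriesBelow g - nonemptyWordSeries g) * PowerSeries.X = PowerSeries.X by
    linear_combination h
  refine biSeries_ext fun s N => ?_
  have hc : ∀ t, biCoeff t N (wordSeriesBelow g - nonemptyWordSeries g) =
      if N = 0 ∧ 0 < t then 1 else 0 := fun t => by
    rw [biCoeff_sub, wordSeriesBelow, nonemptyWordSeries, biCoeff_biSeries, biCoeff_biSeries]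
    rcases Nat.eq_zero_or_pos N with rfl | hN
    · have : 0 < g * t ↔ 0 < t := by simp [Nat.pos_iff_ne_zero]; omega
      simp [this]
    · have : N ≠ 0 := by omega
      simp [Nat.one_le_iff_ne_zero, this]
  rw [biCoeff_sub, biCoeff_X, hc]
  cases s with
  | zero => simp [biCoeff_mul_X_zero]
  | succ s =>
    rw [biCoeff_mul_X_succ, hc]
    rcases Nat.eq_zero_or_pos s with rfl | hs
    · simp
    · simp [hs, hs.ne']

/-- Combinatorially, a nonempty arrangement on a circle is cut at the block (a cluster with the empty
spots behind it) that contains the origin. -/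
theorem nonemptyWordSeries_mul_one_sub_blockSeries {g : ℕ} (hg : 1 ≤ g) :
    nonemptyWordSeries g * (1 - blockSeries g) = theta (blockSeries g) := by
  have hX : (1 - PowerSeries.X : PowerSeries (PowerSeries ℚ)) ≠ 0 := fun h => by
    simpa using congrArg (PowerSeries.coeff 0) h
  have hth : theta (PowerSeries.X : PowerSeries (PowerSeries ℚ)) = PowerSeries.X := by
    refine biSeries_ext fun s N => ?_
    rw [biCoeff_theta, biCoeff_X]
    split_ifs with h
    · simp [h.1]
    · simp
  have h1 := wordSeriesBelow_mul_one_sub_clusterSeries hg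
  have h2 := one_sub_clusterSeries hg
  have h3 := wordSeriesBelow_mul_one_sub_X hg
  have h4 := congrArg theta h2
  rw [theta_sub, theta_mul, theta_sub, theta_sub, hth, theta_one] at h4
  apply mul_right_cancel₀ hX
  rw [h2] at h1
  linear_combination h1 - (1 - blockSeries g) * h3 - h4

/-- With `F = blockSeries g` and `G = nonemptyWordSeries g`: in the relevant coefficient
`G = θ F / (1 - F)` agrees with `θ (∑ F ^ n / n)` summed over `1 ≤ n ≤ k`: the error
`F ^ k * G` only has monomials with at least `k + 1` empty spots. -/
theorem biCoeff_nonemptyWordSeries_eq_sum_pow_blockSeries {g s k : ℕ} (hg : 1 ≤ g)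
    (hks : k < g * s) :
    biCoeff s (g * s - k) (nonemptyWordSeries g) =
      ∑ n ∈ Icc 1 k, (s : ℚ) / n * biCoeff s (g * s - k) (blockSeries g ^ n) := by
  set F := blockSeries g with hF
  set G := nonemptyWordSeries g with hG
  have h0 : G * (1 - F) = theta F := nonemptyWordSeries_mul_one_sub_blockSeries hg
  have hF1 : SuppBelow g 1 F := fun s N h => by
    rw [hF, blockSeries, biCoeff_biSeries, if_neg (by omega)]
  have hG1 : SuppBelow g 1 G := fun s N h => by
    rw [hG, nonemptyWordSeries, biCoeff_biSeries, if_neg (by omega)]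
  have h1 : G = F ^ k * G + ∑ n ∈ Icc 1 k, F ^ (n - 1) * theta F := by
    have h2 : ∑ n ∈ Icc 1 k, F ^ (n - 1) = ∑ n ∈ range k, F ^ n := by
      rw [range_eq_Ico, sum_Ico_eq_sum_range, ← Ico_succ_right_eq_Icc, sum_Ico_eq_sum_range]
      simp
    rw [← sum_mul, h2, ← h0]
    have := geom_sum_mul_neg F k
    linear_combination (-G) * this
  have h2 : biCoeff s (g * s - k) (F ^ k * G) = 0 :=
    (hF1.pow k).mul hG1 s _ (by omega)
  have h3 : biCoeff s (g * s - k) G =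
      biCoeff s (g * s - k) (∑ n ∈ Icc 1 k, F ^ (n - 1) * theta F) := by
    conv_lhs => rw [h1]
    rw [biCoeff_add, h2, zero_add]
  rw [h3, biCoeff_sum]
  refine sum_congr rfl fun n hn => ?_
  rw [mem_Icc] at hn
  have hn0 : (n : ℚ) ≠ 0 := by
    have : n ≠ 0 := by omega
    exact_mod_cast this
  have h4 : biCoeff s (g * s - k) (theta (F ^ n)) =
      n * biCoeff s (g * s - k) (F ^ (n - 1) * theta F) := by
    rw [theta_pow, biCoeff, map_nsmul, map_nsmul, nsmul_eq_mul, biCoeff]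
  rw [biCoeff_theta] at h4
  field_simp
  linear_combination -h4

/-! ### Coefficients of powers as sums over compositions -/

theorem coeff_prod_eq_sum_piAntidiag {R : Type*} [CommRing R] (n d : ℕ)
    (f : Fin n → PowerSeries R) : PowerSeries.coeff d (∏ i, f i) =
      ∑ c ∈ piAntidiag (univ : Finset (Fin n)) d, ∏ i, PowerSeries.coeff (c i) (f i) := by
  rw [PowerSeries.coeff_prod]
  refine sum_nbij' (fun c => ⇑c) (fun c => Finsupp.equivFunOnFinite.symm c) ?_ ?_ ?_ ?_ ?_
  · intro c hc
    simpa using (mem_finsuppAntidiag.1 hc).1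
  · intro c hc
    simpa [mem_finsuppAntidiag] using hc
  · intro c _
    ext
    simp
  · intro c _
    ext
    simp
  · simp

theorem biCoeff_pow (s N n : ℕ) (f : PowerSeries (PowerSeries ℚ)) :
    biCoeff s N (f ^ n) = ∑ mu ∈ piAntidiag (univ : Finset (Fin n)) s,
      ∑ nu ∈ piAntidiag (univ : Finset (Fin n)) N, ∏ i, biCoeff (mu i) (nu i) f := by
  have h : f ^ n = ∏ _i : Fin n, f := by simp
  rw [biCoeff, h, coeff_prod_eq_sum_piAntidiag, map_sum]
  exact sum_congr rfl fun mu _ => coeff_prod_eq_sum_piAntidiag _ _ _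

/-- The substitution `ν = g μ - λ` turns the exponents of `z` into compositions `λ` of `k`. -/
theorem factorial_mul_biCoeff_blockSeries_pow {g s k n : ℕ} (hks : k < g * s) :
    ((g * s - k).factorial : ℚ) * biCoeff s (g * s - k) (blockSeries g ^ n) =
      ∑ lam ∈ compositionsOfLength n k,
        ∑ mu ∈ compositionsOfLength n s with ∀ i, lam i < g * mu i,
          (Nat.multinomial univ (fun i => g * mu i - lam i) : ℚ) *
            ∏ i, (modPFCount g (g * mu i - lam i) : ℚ) := by
  have hR : ∑ lam ∈ compositionsOfLength n k,
        ∑ mu ∈ compositionsOfLength n s with ∀ i, lam i < g * mu i,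
          (Nat.multinomial univ (fun i => g * mu i - lam i) : ℚ) *
            ∏ i, (modPFCount g (g * mu i - lam i) : ℚ) =
      ∑ mu ∈ compositionsOfLength n s,
        ∑ lam ∈ compositionsOfLength n k with ∀ i, lam i < g * mu i,
          (Nat.multinomial univ (fun i => g * mu i - lam i) : ℚ) *
            ∏ i, (modPFCount g (g * mu i - lam i) : ℚ) := by
    simp only [sum_filter]
    exact sum_comm
  rw [hR, biCoeff_pow, mul_sum]
  -- Compositions with a vanishing part contribute nothing: `blockSeries` has no constant term.
  rw [← sum_subset (s₁ := compositionsOfLength n s) (filter_subset _ _)]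
  swap
  · intro mu hmu hmu'
    obtain ⟨i, hi⟩ : ∃ i, mu i = 0 := by
      by_contra! h
      exact hmu' (mem_filter.2 ⟨hmu, fun i => Nat.pos_of_ne_zero (h i)⟩)
    rw [sum_eq_zero, mul_zero]
    intro nu _
    refine prod_eq_zero (mem_univ i) ?_
    simp [blockSeries, hi]
  refine sum_congr rfl fun mu hmu => ?_
  simp only [compositionsOfLength, mem_filter, mem_piAntidiag, mem_univ, implies_true,
    and_true] at hmu
  rw [mul_sum, ← sum_subset (filter_subset (fun nu => ∀ i, 1 ≤ nu i ∧ nu i < g * mu i) _)]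
  swap
  · intro nu hnu hnu'
    obtain ⟨i, hi⟩ : ∃ i, ¬ (1 ≤ nu i ∧ nu i < g * mu i) := by
      by_contra! h
      exact hnu' (mem_filter.2 ⟨hnu, h⟩)
    rw [prod_eq_zero (mem_univ i), mul_zero]
    rw [blockSeries, biCoeff_biSeries, if_neg hi]
  have hsub : ∀ x : Fin n → ℕ, (∀ i, x i ≤ g * mu i) →
      ∑ i, (g * mu i - x i) = g * s - ∑ i, x i := fun x hx => by
    rw [sum_tsub_distrib _ fun i _ => hx i, ← mul_sum, hmu.1]
  refine sum_nbij' (fun nu i => g * mu i - nu i) (fun lam i => g * mu i - lam i) ?_ ?_ ?_ ?_ ?_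
  · intro nu hnu
    simp only [compositionsOfLength, mem_filter, mem_piAntidiag, mem_univ, implies_true,
      and_true] at hnu ⊢
    refine ⟨⟨?_, fun i => ?_⟩, fun i => ?_⟩
    · rw [hsub nu fun i => (hnu.2 i).2.le, hnu.1]
      omega
    · have := hnu.2 i
      omega
    · have := hnu.2 i
      omega
  · intro lam hlam
    simp only [compositionsOfLength, mem_filter, mem_piAntidiag, mem_univ, implies_true,
      and_true] at hlam ⊢
    refine ⟨?_, fun i => ?_⟩
    · rw [hsub lam fun i => (hlam.2 i).le, hlam.1.1]
    · have := hlam.2 i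
      have := hlam.1.2 i
      omega
  · intro nu hnu
    ext i
    have := (mem_filter.1 hnu).2 i
    dsimp only
    omega
  · intro lam hlam
    ext i
    have := (mem_filter.1 hlam).2 i
    dsimp only
    omega
  · intro nu hnu
    rw [mem_filter, mem_piAntidiag] at hnu
    have h1 : ∀ i, g * mu i - (g * mu i - nu i) = nu i := fun i => by
      have := hnu.2 i
      omega
    have h2 : ∏ i, biCoeff (mu i) (nu i) (blockSeries g) =
        (∏ i, (modPFCount g (nu i) : ℚ)) / ∏ i, ((nu i).factorial : ℚ) := by
      rw [← prod_div_distrib]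
      refine prod_congr rfl fun i _ => ?_
      rw [blockSeries, biCoeff_biSeries, if_pos (hnu.2 i)]
    have h3 := Nat.multinomial_spec univ nu
    rw [hnu.1.1] at h3
    have h4 : ∏ i, ((nu i).factorial : ℚ) ≠ 0 :=
      prod_ne_zero_iff.2 fun i _ => by exact_mod_cast (nu i).factorial_ne_zero
    simp only [h1]
    rw [h2, ← h3]
    push_cast
    field_simp

theorem mainTheorem12 (g s k : ℕ) (hg : 1 ≤ g) (hs : 1 ≤ s) (hk : 1 ≤ k) (hks : k < g * s) :
    (s : ℚ) ^ (g * s - k) =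
      s * #(restrictedPF (g * s - k) (modSpots g (g * s - k))) +
      ∑ n ∈ Icc 2 k, (s : ℚ) / n *
        ∑ lam ∈ compositionsOfLength n k,
          ∑ mu ∈ compositionsOfLength n s with ∀ i, lam i < g * mu i,
            (Nat.multinomial univ (fun i => g * mu i - lam i) : ℚ) *
              ∏ i, (#(restrictedPF (g * mu i - lam i) (modSpots g (g * mu i - lam i))) : ℚ) := by
  have hN : 1 ≤ g * s - k ∧ g * s - k < g * s := by omega
  have hfac : ((g * s - k).factorial : ℚ) ≠ 0 := by exact_mod_cast Nat.factorial_ne_zero _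
  have h := congrArg (fun x => ((g * s - k).factorial : ℚ) * x)
    (biCoeff_nonemptyWordSeries_eq_sum_pow_blockSeries hg hks)
  -- The term with a single cluster has no inner sums in the statement and is split off.
  rw [nonemptyWordSeries, biCoeff_biSeries, if_pos hN, mul_div_cancel₀ _ hfac,
    ← add_sum_Ioc_eq_sum_Icc hk, mul_add, mul_sum] at h
  rw [h]
  congr 1
  · rw [pow_one, blockSeries, biCoeff_biSeries, if_pos hN, modPFCount]
    field_simp
    simp
  · refine sum_congr rfl fun n _ => ?_
    rw [mul_left_comm, factorial_mul_biCoeff_blockSeries_pow hks]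
    rfl
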